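/- Let $\hat{\mathbb R}=\mathbb R\cup\{\infty\}$ and $\hat{\mathbb C}=\mathbb C\cup\{\infty\}$, and regard rational functions as maps $\hat{\mathbb C}\to\hat{\mathbb C}$. A circle in $\hat{\mathbb C}$ is either a usual circle in $\mathbb C$, or a line in $\mathbb C$ together with $\infty$. A rational function $g\in\mathbb C(z)$ is called weakly injective (on $\mathbb R$) if there is $z_0\in\mathbb R$ which is not a critical point of $g$ and such that there is no $y_0\in\hat{\mathbb R}$ with $y_0\neq z_0$ and $g(y_0)=g(z_0)$. Let $f,g\in\mathbb C(z)$ be non-constant rational functions such that $f\circ g\in\mathbb R(z)$. Assume that $g$ is weakly injective, and that the curve $\Gamma=g(\hat{\mathbb R})$ is not contained in a circle in $\hat{\mathbb C}$. Then $g\circ f$ maps $\Gamma$ into $\Gamma$, and the map $g\circ f:\Gamma\to\Gamma$ is not injective. -/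

import Mathlib

open scoped OnePoint

namespace RationalCurves

noncomputable section

/-- The map of the Riemann sphere `ℂ ∪ {∞}` to itself induced by a rational function
(written in lowest terms as `num / denom`, with `denom` monic). -/
def toSphere (g : RatFunc ℂ) : OnePoint ℂ → OnePoint ℂ
  | ∞ =>
      if g.denom.natDegree < g.num.natDegree then ∞
      else ((g.num.coeff g.denom.natDegree / g.denom.leadingCoeff : ℂ) : OnePoint ℂ)
  | OnePoint.some z =>
      if g.denom.eval z = 0 then ∞
      else ((g.num.eval z / g.denom.eval z : ℂ) : OnePoint ℂ)

/-- The composition `f ∘ g` of rational functions, that is, `g` substituted into `f`. (For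
non-constant `g` the denominator `f.denom (g)` does not vanish.) -/
def comp (f g : RatFunc ℂ) : RatFunc ℂ :=
  f.eval (algebraMap ℂ (RatFunc ℂ)) g

/-- A rational function is constant if it is an element of `ℂ`. -/
def IsConstant (f : RatFunc ℂ) : Prop :=
  ∃ c : ℂ, f = RatFunc.C c

/-- `f` lies in `ℝ(z)`: it is a quotient of two polynomials with real coefficients. -/
def IsReal (f : RatFunc ℂ) : Prop :=
  ∃ p q : Polynomial ℝ, q ≠ 0 ∧
    f = algebraMap (Polynomial ℂ) (RatFunc ℂ) (p.map Complex.ofRealHom) /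
        algebraMap (Polynomial ℂ) (RatFunc ℂ) (q.map Complex.ofRealHom)

/-- The extended real line `ℝ ∪ {∞}`, as a subset of the Riemann sphere. -/
def extendedReals : Set (OnePoint ℂ) :=
  Set.range (OnePoint.map ((↑) : ℝ → ℂ))

/-- The curve `g(ℝ ∪ {∞})`. -/
def curve (g : RatFunc ℂ) : Set (OnePoint ℂ) :=
  toSphere g '' extendedReals

/-- The point `z ∈ ℂ` is a critical point of `g`: the derivative of `g` vanishes at `z`, where
the chart `w ↦ 1 / w` is used around the value `∞` if `z` is a pole of `g`. -/
def IsCriticalPoint (g : RatFunc ℂ) (z : ℂ) : Prop :=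
  if g.denom.eval z = 0 then deriv (fun w => g.denom.eval w / g.num.eval w) z = 0
  else deriv (fun w => g.num.eval w / g.denom.eval w) z = 0

/-- `g` is weakly injective on `ℝ`: some real point `z₀` is not a critical point of `g` and is
the only point of `ℝ ∪ {∞}` at which `g` takes the value `g z₀`. -/
def WeaklyInjective (g : RatFunc ℂ) : Prop :=
  ∃ z₀ : ℝ, ¬ IsCriticalPoint g (z₀ : ℂ) ∧
    ∀ y ∈ extendedReals, toSphere g y = toSphere g ((z₀ : ℂ) : OnePoint ℂ) →
      y = ((z₀ : ℂ) : OnePoint ℂ)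

/-- A circle in the Riemann sphere: either a usual circle in `ℂ` (of positive radius), or a real
affine line in `ℂ` together with the point `∞`. -/
def IsCircle (S : Set (OnePoint ℂ)) : Prop :=
  (∃ (c : ℂ) (r : ℝ), 0 < r ∧ S = ((↑) : ℂ → OnePoint ℂ) '' Metric.sphere c r) ∨
  (∃ a v : ℂ, v ≠ 0 ∧
    S = insert ∞ (((↑) : ℂ → OnePoint ℂ) '' Set.range (fun t : ℝ => a + (t : ℂ) * v)))

end

end RationalCurves

/-!
Write `h = f ∘ g`, a real rational function, and `Γ` for the curve. Since `h` preserves the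
extended real line, `g ∘ f` maps `Γ = g(ℝ ∪ {∞})` into itself. Suppose that `g ∘ f` is injective on
`Γ`. Then a real fibre of `h` is mapped to one point by `g`, so weak injectivity of `g` passes to
`h`: there is a real `z₀` which is the only real point with value `h z₀`, and `h` is injective on
the reals near `z₀`. A function on a circle omitting a value would have an extremum at such a point,
so `h` takes every real value on the extended real line (`exists_toSphere_eq_coe`). As `f` is
injective on `Γ` and `g` is injective on `f(Γ)`, it follows that `h` is injective on the reals.

The second half is Galois-theoretic. Let `k` be a countable, algebraically closed subfield of `ℂ`
that is stable under complex conjugation and contains the coefficients of `g` and `h`, and let `x`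
be real and not in `k`. Complex conjugation `σ` permutes the finite fibre of `h` through `x` and
fixes only `x` in it. If `g y = g x`, some automorphism `u` of `ℂ` over `k` maps `x` to `y`, and
`τ = u σ u⁻¹` permutes the same fibre and fixes only `y`. For parity reasons a power of `ρ = σ τ`
maps `x` to `y` (`exists_pow_apply_eq`). This power is an automorphism over `k`, hence fixes `g x`
because `g y = g x`; its inverse maps `x` to the complex conjugate of `y`, which therefore also
lies in the fibre of `g` (`IsSmall.conj_mem_fibre`).

So the fibre of `g = N / D` through a generic real `x` is stable under conjugation. It consists of
simple roots of `N - s D`, where `s = g x`, so this polynomial is real up to a factor. Using two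
such values `s₁ ≠ s₂`, the Möbius transformation `(w - s₁) / (w - s₂)` of `w = g z` is, up to a
constant, real on the real line, and `Γ` lies on a circle.
-/

namespace RationalCurves

open Polynomial Cardinal ComplexConjugate Filter Topology

/-! ### Automorphisms of the complex numbers -/

/-- Two embeddings of a countable ring `R` into an uncountable algebraically closed field differ by
an automorphism of the field: transcendence bases over both copies of `R` have the cardinality of
the field. -/
theorem exists_ringEquiv_comp_eq {R K : Type} [CommRing R] [Nontrivial R] [Field K] [IsAlgClosed K]
    (hR : #R ≤ ℵ₀) (hK : ℵ₀ < #K) (i j : R →+* K)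
    (hi : Function.Injective i) (hj : Function.Injective j) :
    ∃ e : K ≃+* K, ∀ r, e (i r) = j r := by
  -- The two structures of an `R`-algebra have to live on different types.
  have key : ∀ (L : Type) [Field L] [IsAlgClosed L] [Algebra R K] [Algebra R L],
      Function.Injective (algebraMap R K) → Function.Injective (algebraMap R L) → #L = #K →
      ∃ e : K ≃+* L, ∀ r, e (algebraMap R K r) = algebraMap R L r := by
    intro L _ _ _ _ hK' hL' hL
    have := (faithfulSMul_iff_algebraMap_injective R K).2 hK'
    have := (faithfulSMul_iff_algebraMap_injective R L).2 hL'
    obtain ⟨s, hs⟩ := exists_isTranscendenceBasis R K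
    obtain ⟨t, ht⟩ := exists_isTranscendenceBasis R L
    have h1 := IsAlgClosed.cardinal_eq_cardinal_transcendence_basis_of_aleph0_lt' _ hs hR hK
    have h2 := IsAlgClosed.cardinal_eq_cardinal_transcendence_basis_of_aleph0_lt' _ ht hR
      (hL ▸ hK)
    obtain ⟨e⟩ := Cardinal.eq.1 (h1.symm.trans (hL.symm.trans h2))
    let _ := IsAlgClosed.isAlgClosure_of_transcendence_basis _ hs
    let _ := IsAlgClosed.isAlgClosure_of_transcendence_basis _ ht
    let E : Algebra.adjoin R (Set.range ((↑) : s → K)) ≃ₐ[R]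
        Algebra.adjoin R (Set.range ((↑) : t → L)) :=
      (hs.1.aevalEquiv.symm.trans (MvPolynomial.renameEquiv R e)).trans ht.1.aevalEquiv
    refine ⟨IsAlgClosure.equivOfEquiv K L E.toRingEquiv, fun r => ?_⟩
    have := IsAlgClosure.equivOfEquiv_algebraMap K L E.toRingEquiv (algebraMap R _ r)
    rw [← IsScalarTower.algebraMap_apply] at this
    rw [this]
    change algebraMap _ L (E (algebraMap R _ r)) = _
    rw [E.commutes, ← IsScalarTower.algebraMap_apply]
  exact @key K _ _ i.toAlgebra j.toAlgebra hi hj rfl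

/-- A countable subfield of `ℂ` that is algebraically closed and stable under complex conjugation.
The points outside of it play the role of generic points. -/
structure IsSmall (k : Subfield ℂ) : Prop where
  countable : (k : Set ℂ).Countable
  conj_mem : ∀ z ∈ k, conj z ∈ k
  root_mem : ∀ P : ℂ[X], P ≠ 0 → (∀ n, P.coeff n ∈ k) → ∀ z, P.eval z = 0 → z ∈ k

theorem exists_isSmall (S : Set ℂ) (hS : S.Countable) :
    ∃ k : Subfield ℂ, IsSmall k ∧ S ⊆ k := by
  let k₀ : Subfield ℂ := Subfield.closure (S ∪ conj '' S)
  have hk₀ : Countable k₀ := by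
    rw [← Cardinal.mk_le_aleph0_iff]
    refine (Subfield.cardinalMk_closure_le_max _).trans (max_le ?_ le_rfl)
    rw [Cardinal.le_aleph0_iff_set_countable]
    exact hS.union (hS.image _)
  have hconj : ∀ z ∈ k₀, conj z ∈ k₀ := by
    have : k₀ ≤ k₀.comap (starRingEnd ℂ) := by
      refine Subfield.closure_le.2 ?_
      rintro z (hz | ⟨w, hw, rfl⟩)
      · exact Subfield.subset_closure (Or.inr ⟨z, hz, rfl⟩)
      · refine Subfield.subset_closure (Or.inl ?_)
        simpa using hw
    exact this
  refine ⟨(algebraicClosure k₀ ℂ).toSubfield, ⟨?_, ?_, ?_⟩, ?_⟩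
  · refine (Algebraic.countable k₀ ℂ).mono fun z hz => ?_
    exact mem_algebraicClosure_iff.1 hz
  · intro z hz
    change IsIntegral k₀ z at hz
    change IsIntegral k₀ (conj z)
    obtain ⟨P, hP, hz⟩ := hz
    let c : k₀ →+* k₀ := ((starRingEnd ℂ).comp k₀.subtype).codRestrict k₀ fun x => hconj _ x.2
    refine ⟨P.map c, hP.map c, ?_⟩
    rw [eval₂_map]
    have h := congrArg (starRingEnd ℂ) hz
    rw [hom_eval₂, map_zero] at h
    exact h
  · intro P hP hcoe z hz
    change IsIntegral k₀ z
    have hl : P ∈ lifts (algebraMap (algebraicClosure k₀ ℂ) ℂ) := by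
      rw [lifts_iff_coeff_lifts]
      exact fun n => ⟨⟨_, hcoe n⟩, rfl⟩
    obtain ⟨Q, rfl⟩ := (mem_lifts _).1 hl
    have h1 : IsAlgebraic (algebraicClosure k₀ ℂ) z :=
      ⟨Q, by rintro rfl; simp at hP, by rwa [eval_map_algebraMap] at hz⟩
    exact isIntegral_trans (R := k₀) z h1.isIntegral
  · intro z hz
    exact (algebraicClosure k₀ ℂ).algebraMap_mem
      ⟨z, Subfield.subset_closure (Or.inl hz)⟩

theorem map_eval_of_fixed {k : Subfield ℂ} {φ : ℂ ≃+* ℂ} (hφ : ∀ a ∈ k, φ a = a) {P : ℂ[X]}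
    (hP : ∀ n, P.coeff n ∈ k) (z : ℂ) : φ (P.eval z) = P.eval (φ z) := by
  have : P.map (φ : ℂ →+* ℂ) = P := by
    ext n
    simpa using hφ _ (hP n)
  conv_rhs => rw [← this]
  simpa using (eval_map_apply (f := (φ : ℂ →+* ℂ)) (p := P) z).symm

/-- Automorphisms of `ℂ` over `k` act transitively on generic points. -/
theorem IsSmall.exists_ringEquiv {k : Subfield ℂ} (hk : IsSmall k) {x y : ℂ} (hx : x ∉ k)
    (hy : y ∉ k) : ∃ u : ℂ ≃+* ℂ, (∀ a ∈ k, u a = a) ∧ u x = y := by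
  have hinj : ∀ z ∉ k, Function.Injective (eval₂RingHom k.subtype z) := by
    intro z hz
    rw [injective_iff_map_eq_zero]
    intro P hP
    by_contra h0
    refine hz (hk.root_mem (P.map k.subtype) ?_ ?_ z ?_)
    · rwa [Ne, Polynomial.map_eq_zero]
    · intro n
      rw [coeff_map]
      exact (P.coeff n).2
    · rwa [eval_map]
  have : Countable k := hk.countable.to_subtype
  have hR : #(Polynomial k) ≤ ℵ₀ := by
    refine Polynomial.cardinalMk_le_max.trans (max_le (Cardinal.mk_le_aleph0) le_rfl)
  obtain ⟨u, hu⟩ := exists_ringEquiv_comp_eq hR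
    (by rw [Cardinal.mk_complex]; exact Cardinal.aleph0_lt_continuum) _ _ (hinj x hx) (hinj y hy)
  refine ⟨u, fun a ha => ?_, ?_⟩
  · simpa using hu (C ⟨a, ha⟩)
  · simpa using hu X

/-! ### Two involutions with a single fixed point -/

/-- If two involutions of a finite set have unique fixed points `x` and `y`, then a power of their
product maps `x` to `y`: both act as reflections on the orbit of `x` under the product, the period
of `x` is odd as `x` is the only fixed point of `σ`, and so `τ` has a fixed point on the orbit
too. -/
theorem exists_pow_apply_eq {α : Type*} (σ τ : Equiv.Perm α) (hσ : ∀ a, σ (σ a) = a)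
    (hτ : ∀ a, τ (τ a) = a) {Ω : Set α} (hΩ : Ω.Finite) (hσΩ : ∀ a ∈ Ω, σ a ∈ Ω)
    (hτΩ : ∀ a ∈ Ω, τ a ∈ Ω) {x y : α} (hx : x ∈ Ω) (hσx : σ x = x)
    (hσ' : ∀ a ∈ Ω, σ a = a → a = x) (hτ' : ∀ a ∈ Ω, τ a = a → a = y) :
    ∃ j : ℕ, ((σ * τ) ^ j) x = y := by
  set ρ := σ * τ with hρ
  have hmem : ∀ j : ℕ, (ρ ^ j) x ∈ Ω := by
    intro j
    induction j with
    | zero => simpa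
    | succ j ih =>
      rw [pow_succ', Equiv.Perm.mul_apply]
      exact hσΩ _ (hτΩ _ ih)
  have hσρ : ∀ j : ℕ, σ ((ρ ^ j) x) = (ρ ^ j)⁻¹ x := by
    have hσi : σ⁻¹ = σ := by
      ext a
      rw [Equiv.Perm.inv_eq_iff_eq, hσ]
    have hτi : τ⁻¹ = τ := by
      ext a
      rw [Equiv.Perm.inv_eq_iff_eq, hτ]
    have hσσ : σ * σ = 1 := by
      ext a
      simp [hσ]
    have h1 : σ * ρ * σ⁻¹ = ρ⁻¹ := by
      rw [hρ, mul_inv_rev, hτi, hσi, ← mul_assoc, hσσ, one_mul]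
    intro j
    have h2 : σ * ρ ^ j * σ⁻¹ = (ρ ^ j)⁻¹ := by rw [← conj_pow, h1, inv_pow]
    rw [← h2, hσi, Equiv.Perm.mul_apply, Equiv.Perm.mul_apply, hσx]
  have hτρ : ∀ j : ℕ, τ ((ρ ^ j) x) = (ρ ^ (j + 1))⁻¹ x := by
    intro j
    rw [← hσρ, pow_succ', Equiv.Perm.mul_apply, hρ, Equiv.Perm.mul_apply, hσ]
  obtain ⟨a, b, hab, heq⟩ : ∃ a b : ℕ, a < b ∧ (ρ ^ a) x = (ρ ^ b) x := by
    obtain ⟨a, -, b, -, hne, h⟩ := Set.infinite_univ.exists_ne_map_eq_of_mapsTo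
      (f := fun j : ℕ => (ρ ^ j) x) (fun j _ => hmem j) hΩ
    rcases lt_or_gt_of_ne hne with h' | h'
    · exact ⟨a, b, h', h⟩
    · exact ⟨b, a, h', h.symm⟩
  have hex : ∃ m : ℕ, 0 < m ∧ (ρ ^ m) x = x := by
    refine ⟨b - a, by omega, ?_⟩
    have : b = a + (b - a) := by omega
    rw [this, pow_add, Equiv.Perm.mul_apply] at heq
    exact ((ρ ^ a).injective heq).symm
  classical
  obtain ⟨hm, hmx⟩ := Nat.find_spec hex
  set m := Nat.find hex
  have hinv : ∀ i j : ℕ, i + j = m → (ρ ^ i)⁻¹ x = (ρ ^ j) x := by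
    intro i j h
    rw [Equiv.Perm.inv_eq_iff_eq, ← Equiv.Perm.mul_apply, ← pow_add, h, hmx]
  rcases Nat.even_or_odd' m with ⟨j, hj | hj⟩
  · -- An even period would give a second fixed point of `σ` on the orbit.
    exfalso
    have h1 : (ρ ^ j) x = x :=
      hσ' _ (hmem j) (by rw [hσρ, hinv j j (by omega)])
    exact Nat.find_min hex (m := j) (by omega) ⟨by omega, h1⟩
  · exact ⟨j, hτ' _ (hmem j) (by rw [hτρ, hinv (j + 1) j (by omega)])⟩

/-! ### Fibres over generic real values -/

theorem eval_mem {k : Subfield ℂ} {P : ℂ[X]} (hP : ∀ n, P.coeff n ∈ k) {z : ℂ} (hz : z ∈ k) :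
    P.eval z ∈ k := by
  rw [eval_eq_sum_range]
  exact sum_mem fun i _ => mul_mem (hP i) (pow_mem hz i)

theorem not_isRoot_of_isCoprime {N D : ℂ[X]} (h : IsCoprime N D) {z : ℂ} (hN : N.eval z = 0) :
    D.eval z ≠ 0 := by
  intro hD
  obtain ⟨a, b, hab⟩ := h
  simpa [hN, hD] using congrArg (Polynomial.eval z) hab

theorem sub_C_mul_ne_zero {N D : ℂ[X]} (hlin : LinearIndependent ℂ ![N, D]) (s : ℂ) :
    N - C s * D ≠ 0 := by
  intro h
  rw [LinearIndependent.pair_iff] at hlin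
  have := hlin 1 (-s) (by rw [smul_eq_C_mul, smul_eq_C_mul, ← h, C_1, C_neg]; ring)
  exact one_ne_zero this.1

theorem finite_fibre {N D : ℂ[X]} (hlin : LinearIndependent ℂ ![N, D]) (s : ℂ) :
    {z : ℂ | N.eval z = s * D.eval z}.Finite := by
  refine (finite_setOfPred_isRoot (sub_C_mul_ne_zero hlin s)).subset fun z hz => ?_
  have hz : N.eval z = s * D.eval z := hz
  simp [IsRoot, hz]

theorem IsSmall.eval_ne_zero {k : Subfield ℂ} (hk : IsSmall k) {P : ℂ[X]} (h0 : P ≠ 0)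
    (hP : ∀ n, P.coeff n ∈ k) {z : ℂ} (hz : z ∉ k) : P.eval z ≠ 0 :=
  fun h => hz (hk.root_mem P h0 hP z h)

/-- A rational function over `k` does not take the same value at a generic point and at a point
of `k`. -/
theorem IsSmall.notMem_of_fibre {k : Subfield ℂ} (hk : IsSmall k) {N D : ℂ[X]}
    (hN : ∀ n, N.coeff n ∈ k) (hD : ∀ n, D.coeff n ∈ k) (hND : IsCoprime N D)
    (hlin : LinearIndependent ℂ ![N, D]) {x y : ℂ} (hx : x ∉ k)
    (hy : N.eval y * D.eval x = N.eval x * D.eval y) : y ∉ k := by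
  intro hyk
  have hpoly : C (-D.eval y) * N + C (N.eval y) * D = 0 := by
    by_contra h0
    refine hk.eval_ne_zero h0 (fun n => ?_) hx ?_
    · rw [coeff_add, coeff_C_mul, coeff_C_mul]
      exact add_mem (mul_mem (neg_mem (eval_mem hD hyk)) (hN n)) (mul_mem (eval_mem hN hyk) (hD n))
    · simp only [eval_add, eval_mul, eval_C]
      linear_combination hy
  rw [LinearIndependent.pair_iff] at hlin
  obtain ⟨h1, h2⟩ := hlin (-D.eval y) (N.eval y) (by rw [smul_eq_C_mul, smul_eq_C_mul, hpoly])
  exact not_isRoot_of_isCoprime hND h2 (neg_eq_zero.1 h1)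

theorem conj_eval (P : ℂ[X]) (hP : ∀ n, conj (P.coeff n) = P.coeff n) (z : ℂ) :
    conj (P.eval z) = P.eval (conj z) := by
  have : P.map (starRingEnd ℂ) = P := by
    ext n
    simpa using hP n
  conv_rhs => rw [← this]
  exact (eval_map_apply (f := starRingEnd ℂ) (p := P) z).symm

/-- Suppose that the real function `P / Q` is constant on the fibre of `N / D` through the generic
real point `x`, and that `x` is the only real point of its fibre under `P / Q`. Then the fibre of
`N / D` through `x` is stable under complex conjugation. For `y` in this fibre one compares complex
conjugation with its conjugate by an automorphism of `ℂ` over `k` that maps `x` to `y`. -/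
theorem IsSmall.conj_mem_fibre {k : Subfield ℂ} (hk : IsSmall k) {N D P Q : ℂ[X]}
    (hN : ∀ n, N.coeff n ∈ k) (hD : ∀ n, D.coeff n ∈ k) (hND : IsCoprime N D)
    (hlin : LinearIndependent ℂ ![N, D])
    (hP : ∀ n, P.coeff n ∈ k) (hQ : ∀ n, Q.coeff n ∈ k) (hlin' : LinearIndependent ℂ ![P, Q])
    (hPr : ∀ n, conj (P.coeff n) = P.coeff n) (hQr : ∀ n, conj (Q.coeff n) = Q.coeff n)
    {x : ℝ} (hx : (x : ℂ) ∉ k)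
    (hfib : ∀ y, N.eval y * D.eval (x : ℂ) = N.eval (x : ℂ) * D.eval y →
      P.eval y * Q.eval (x : ℂ) = P.eval (x : ℂ) * Q.eval y)
    (huniq : ∀ x' : ℝ, P.eval (x' : ℂ) * Q.eval (x : ℂ) = P.eval (x : ℂ) * Q.eval (x' : ℂ) →
      x' = x)
    {y : ℂ} (hy : N.eval y * D.eval (x : ℂ) = N.eval (x : ℂ) * D.eval y) :
    N.eval (conj y) * D.eval (x : ℂ) = N.eval (x : ℂ) * D.eval (conj y) := by
  have hyk := hk.notMem_of_fibre hN hD hND hlin hx hy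
  have hD0 : D ≠ 0 := hlin.ne_zero 1
  have hQ0 : Q ≠ 0 := hlin'.ne_zero 1
  have hDx := hk.eval_ne_zero hD0 hD hx
  have hQx := hk.eval_ne_zero hQ0 hQ hx
  have hDy := hk.eval_ne_zero hD0 hD hyk
  have hQy := hk.eval_ne_zero hQ0 hQ hyk
  set t : ℂ := P.eval (x : ℂ) / Q.eval (x : ℂ) with ht
  set s : ℂ := N.eval (x : ℂ) / D.eval (x : ℂ) with hs
  have hPQt : ∀ z, P.eval z = t * Q.eval z ↔
      P.eval z * Q.eval (x : ℂ) = P.eval (x : ℂ) * Q.eval z := by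
    intro z
    rw [ht, div_mul_eq_mul_div, eq_div_iff hQx]
  have hNDs : ∀ z, N.eval z = s * D.eval z ↔
      N.eval z * D.eval (x : ℂ) = N.eval (x : ℂ) * D.eval z := by
    intro z
    rw [hs, div_mul_eq_mul_div, eq_div_iff hDx]
  obtain ⟨u, huk, hux⟩ := hk.exists_ringEquiv hx hyk
  have huk' : ∀ a ∈ k, u.symm a = a := fun a ha => by
    rw [RingEquiv.symm_apply_eq, huk a ha]
  let Ω : Set ℂ := {z | P.eval z = t * Q.eval z}
  have hxΩ : (x : ℂ) ∈ Ω := (hPQt x).2 rfl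
  have hyΩ : y ∈ Ω := (hPQt y).2 (hfib y hy)
  have hΩ : Ω.Finite := finite_fibre hlin' t
  have hut : u t = t := by
    rw [ht, map_div₀, map_eval_of_fixed huk hP, map_eval_of_fixed huk hQ, hux, ← ht,
      div_eq_iff hQy]
    exact hyΩ
  have hut' : u.symm t = t := by rw [RingEquiv.symm_apply_eq, hut]
  have huΩ : ∀ z ∈ Ω, u z ∈ Ω := fun z (hz : _ = _) => by
    change _ = _
    rw [← map_eval_of_fixed huk hP, hz, map_mul, hut, map_eval_of_fixed huk hQ]
  have huΩ' : ∀ z ∈ Ω, u.symm z ∈ Ω := fun z (hz : _ = _) => by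
    change _ = _
    rw [← map_eval_of_fixed huk' hP, hz, map_mul, hut', map_eval_of_fixed huk' hQ]
  have hct : conj t = t := by
    rw [ht, map_div₀, conj_eval P hPr, conj_eval Q hQr, Complex.conj_ofReal]
  have hcΩ : ∀ z ∈ Ω, conj z ∈ Ω := fun z (hz : _ = _) => by
    change _ = _
    rw [← conj_eval P hPr, hz, map_mul, hct, conj_eval Q hQr]
  have hreal : ∀ z ∈ Ω, conj z = z → z = x := by
    intro z hz hz'
    obtain ⟨r, rfl⟩ := Complex.conj_eq_iff_real.1 hz'
    rw [huniq r ((hPQt r).1 hz)]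
  let c : ℂ ≃+* ℂ := starRingAut
  have hc : ∀ z, c z = conj z := fun z => rfl
  -- The conjugate by `u` of complex conjugation has `y` as its only fixed point in the fibre `Ω`.
  let τ : ℂ ≃+* ℂ := (u.symm.trans c).trans u
  have hτ : ∀ z, τ z = u (conj (u.symm z)) := fun z => rfl
  obtain ⟨j, hj⟩ := exists_pow_apply_eq c.toEquiv τ.toEquiv (x := (x : ℂ)) (y := y)
    (fun z => by change conj (conj z) = z; simp)
    (fun z => by change τ (τ z) = z; simp [hτ]) hΩ hcΩ
    (fun z hz => huΩ _ (hcΩ _ (huΩ' _ hz))) hxΩ (by change conj _ = _; simp) hreal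
    (fun z hz (h : u (conj (u.symm z)) = z) => by
      rw [← RingEquiv.eq_symm_apply] at h
      rw [← hux, ← hreal _ (huΩ' _ hz) h, RingEquiv.apply_symm_apply])
  let ρ : ℂ ≃+* ℂ := τ.trans c
  have hρ : ∀ z, ρ z = conj (τ z) := fun z => rfl
  have hρk : ∀ a ∈ k, ρ a = a := by
    intro a ha
    rw [hρ, hτ, huk' a ha, huk _ (hk.conj_mem a ha), Complex.conj_conj]
  have hcρ : ∀ z, ρ (conj (ρ z)) = conj z := by
    intro z
    simp [hρ, hτ]
  have hjρ : (ρ^[j]) x = y := by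
    rw [← hj]
    clear hj
    induction j with
    | zero => rfl
    | succ j ih => rw [Function.iterate_succ_apply', ih, pow_succ']; rfl
  -- Every power of `ρ` mapping `x` to `y` fixes `s`, hence so does its inverse, which maps
  -- `x` to the conjugate of `y`.
  have key : ∀ (i : ℕ) (v z w : ℂ), (ρ^[i]) z = w → N.eval w = (ρ^[i] v) * D.eval w →
      N.eval z = v * D.eval z := by
    intro i
    induction i with
    | zero =>
      rintro v z w rfl h
      exact h
    | succ i ih =>
      rintro v z w rfl h
      rw [Function.iterate_succ_apply, Function.iterate_succ_apply] at h
      have := ih (ρ v) (ρ z) _ rfl h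
      rw [← map_eval_of_fixed hρk hN, ← map_eval_of_fixed hρk hD, ← map_mul] at this
      exact ρ.injective this
  have hs_fix : ∀ i : ℕ, ρ^[i] s = N.eval (ρ^[i] x) / D.eval (ρ^[i] x) := by
    intro i
    induction i with
    | zero => rfl
    | succ i ih =>
      rw [Function.iterate_succ_apply', ih, map_div₀, map_eval_of_fixed hρk hN,
        map_eval_of_fixed hρk hD, Function.iterate_succ_apply']
  have hρs : ρ^[j] s = s := by
    rw [hs_fix, hjρ, div_eq_iff hDy]
    exact (hNDs y).2 hy
  have hback : ∀ i : ℕ, ρ^[i] (conj (ρ^[i] x)) = x := by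
    intro i
    induction i with
    | zero => simp
    | succ i ih => rw [Function.iterate_succ_apply, Function.iterate_succ_apply' ρ i (x : ℂ),
        hcρ, ih]
  rw [← hNDs]
  refine key j s (conj y) x ?_ ?_
  · rw [← hjρ, hback]
  · rw [hρs]
    exact (hNDs x).2 rfl

/-- If the fibre of `N / D` through the generic point `x` is stable under complex conjugation, then
the polynomial `N - s * D` with `s = N(x) / D(x)`, whose roots are the points of this fibre, is real
up to a constant factor. -/
theorem IsSmall.exists_real_pencil_member {k : Subfield ℂ} (hk : IsSmall k) {N D : ℂ[X]}
    (hN : ∀ n, N.coeff n ∈ k) (hD : ∀ n, D.coeff n ∈ k) (hND : IsCoprime N D)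
    (hlin : LinearIndependent ℂ ![N, D]) {x : ℂ} (hx : x ∉ k)
    (hconj : ∀ y, N.eval y * D.eval x = N.eval x * D.eval y →
      N.eval (conj y) * D.eval x = N.eval x * D.eval (conj y)) :
    ∃ μ : ℂ, μ ≠ 0 ∧ ∀ n, conj (μ * (N.coeff n - N.eval x / D.eval x * D.coeff n)) =
      μ * (N.coeff n - N.eval x / D.eval x * D.coeff n) := by
  have hD0 : D ≠ 0 := hlin.ne_zero 1
  have hDx := hk.eval_ne_zero hD0 hD hx
  set s : ℂ := N.eval x / D.eval x with hs
  set S : ℂ[X] := N - C s * D with hS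
  have hSc : ∀ n, S.coeff n = N.coeff n - s * D.coeff n := fun n => by simp [hS]
  have hSroot : ∀ z, S.eval z = 0 ↔ N.eval z * D.eval x = N.eval x * D.eval z := by
    intro z
    simp only [hS, eval_sub, eval_mul, eval_C]
    rw [sub_eq_zero, hs, div_mul_eq_mul_div, eq_div_iff hDx]
  have hS0 : S ≠ 0 := sub_C_mul_ne_zero hlin s
  have hW : wronskian N D ≠ 0 := by
    intro h
    obtain ⟨h1, h2⟩ := hND.wronskian_eq_zero_iff.1 h
    obtain ⟨a, ha⟩ := natDegree_eq_zero.1 (derivative_eq_zero.1 h1)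
    obtain ⟨b, hb⟩ := natDegree_eq_zero.1 (derivative_eq_zero.1 h2)
    rw [LinearIndependent.pair_iff] at hlin
    have := hlin b (-a) (by rw [← ha, ← hb, smul_eq_C_mul, smul_eq_C_mul, C_neg]; ring)
    exact hD0 (by rw [← hb, this.1, C_0])
  have hWk : ∀ n, (wronskian N D).coeff n ∈ k := by
    have hmul : ∀ A B : ℂ[X], (∀ n, A.coeff n ∈ k) → (∀ n, B.coeff n ∈ k) →
        ∀ n, (A * B).coeff n ∈ k := fun A B hA hB n => by
      rw [coeff_mul]
      exact sum_mem fun i _ => mul_mem (hA _) (hB _)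
    have hder : ∀ A : ℂ[X], (∀ n, A.coeff n ∈ k) → ∀ n, (derivative A).coeff n ∈ k :=
      fun A hA n => by
        rw [coeff_derivative]
        exact mul_mem (hA _) (add_mem (natCast_mem k n) (one_mem k))
    intro n
    rw [wronskian, coeff_sub]
    exact sub_mem (hmul _ _ hN (hder _ hD) n) (hmul _ _ (hder _ hN) hD n)
  -- At a multiple root the Wronskian of `N` and `D` vanishes, so that root would lie in `k`.
  have hsep : S.roots.Nodup := by
    refine Multiset.nodup_iff_count_le_one.2 fun y => ?_
    rw [count_roots]
    by_contra! hlt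
    obtain ⟨h1, h2⟩ := (one_lt_rootMultiplicity_iff_isRoot hS0).1 hlt
    have hy := hk.notMem_of_fibre hN hD hND hlin hx ((hSroot y).1 h1)
    refine hk.eval_ne_zero hW hWk hy ?_
    simp only [IsRoot, hS, derivative_sub, derivative_mul, derivative_C, zero_mul, zero_add,
      eval_sub, eval_mul, eval_C] at h1 h2
    simp only [wronskian, eval_sub, eval_mul]
    linear_combination (derivative D).eval y * h1 - D.eval y * h2
  have hSc0 : S.map (starRingEnd ℂ) ≠ 0 := by
    rwa [Ne, Polynomial.map_eq_zero]
  have hle : S.roots ≤ (S.map (starRingEnd ℂ)).roots := by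
    refine (Multiset.le_iff_subset hsep).2 fun y hy => ?_
    rw [mem_roots hS0, IsRoot, hSroot] at hy
    rw [mem_roots hSc0, IsRoot]
    have h := (hSroot _).2 (hconj y hy)
    have h' := eval_map_apply (f := starRingEnd ℂ) (p := S) (conj y)
    rw [h, map_zero, Complex.conj_conj] at h'
    exact h'
  have hdvd : S ∣ S.map (starRingEnd ℂ) := (IsAlgClosed.splits S).dvd_of_roots_le_roots hS0 hle
  obtain ⟨R, hR⟩ := hdvd
  have hR0 : R ≠ 0 := by
    rintro rfl
    exact hSc0 (by rw [hR, mul_zero])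
  have hRdeg : R.natDegree = 0 := by
    have := congrArg natDegree hR
    rw [natDegree_map, natDegree_mul hS0 hR0] at this
    omega
  obtain ⟨r, rfl⟩ := natDegree_eq_zero.1 hRdeg
  have hr : ∀ n, conj (S.coeff n) = r * S.coeff n := by
    intro n
    have := congrArg (fun A => coeff A n) hR
    simpa [mul_comm] using this
  -- With this factor the leading coefficient is positive, so that `S` equals its complex conjugate.
  refine ⟨conj S.leadingCoeff, by simpa using hS0, fun n => ?_⟩
  rw [← hSc, map_mul, Complex.conj_conj, hr, leadingCoeff, hr]
  ring

/-! ### Points with homogeneous coordinates and circles -/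

/-- The point of the Riemann sphere with homogeneous coordinates `[a : b]`. It is meaningful for
`(a, b) ≠ (0, 0)` only. -/
noncomputable def ofCoords (a b : ℂ) : OnePoint ℂ :=
  if b = 0 then ∞ else ((a / b : ℂ) : OnePoint ℂ)

theorem ofCoords_eq_iff {a b c d : ℂ} (h : a ≠ 0 ∨ b ≠ 0) (h' : c ≠ 0 ∨ d ≠ 0) :
    ofCoords a b = ofCoords c d ↔ a * d = c * b := by
  unfold ofCoords
  split_ifs with h1 h2 h2
  · simp [h1, h2]
  · subst h1
    simp only [OnePoint.infty_ne_coe, false_iff, mul_zero]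
    simp_all
  · subst h2
    simp only [OnePoint.coe_ne_infty, false_iff, mul_zero]
    simp_all
  · rw [OnePoint.coe_eq_coe, div_eq_div_iff h1 h2]

theorem exists_isCircle_of_im_eq_zero {s₁ s₂ ν : ℂ} (hs : s₁ ≠ s₂) (hν : ν ≠ 0) (hν' : ν.im = 0) :
    ∃ T, IsCircle T ∧ ∀ a b : ℂ,
      (ν * ((a - s₁ * b) * conj (a - s₂ * b))).im = 0 → ofCoords a b ∈ T := by
  refine ⟨_, Or.inr ⟨s₁, s₁ - s₂, sub_ne_zero.2 hs, rfl⟩, fun a b h => ?_⟩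
  unfold ofCoords
  split_ifs with hb
  · exact Set.mem_insert _ _
  refine Set.mem_insert_of_mem _ ⟨_, ?_, rfl⟩
  have hν0 : ν.re ≠ 0 := fun h => hν (Complex.ext h hν')
  set w := a / b with hw
  set d := s₁ - s₂ with hd
  have hd0 : d ≠ 0 := sub_ne_zero.2 hs
  have haw : a = w * b := by rw [hw, div_mul_cancel₀ _ hb]
  have h1 : ((w - s₁) * conj d).im = 0 := by
    have e : ν * ((a - s₁ * b) * conj (a - s₂ * b)) =
        ((ν.re * Complex.normSq b : ℝ) : ℂ) * ((w - s₁) * conj (w - s₂)) := by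
      have : ν = (ν.re : ℂ) := Complex.ext rfl (by simpa using hν')
      push_cast
      rw [Complex.normSq_eq_conj_mul_self, ← this, haw, map_sub, map_mul, map_mul, map_sub]
      ring
    rw [e, Complex.im_ofReal_mul] at h
    have h2 := (mul_eq_zero.1 h).resolve_left
      (mul_ne_zero hν0 (Complex.normSq_pos.2 hb).ne')
    have e2 : s₂ = s₁ - d := by rw [hd]; ring
    rw [e2] at h2
    simp only [Complex.mul_im, Complex.sub_re, Complex.sub_im, Complex.conj_re,
      Complex.conj_im] at h2 ⊢
    linear_combination h2
  refine ⟨((w - s₁) * conj d).re / Complex.normSq d, ?_⟩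
  have h3 : (w - s₁) * conj d = ((((w - s₁) * conj d).re : ℝ) : ℂ) :=
    Complex.ext rfl (by simpa using h1)
  have hdn : (Complex.normSq d : ℂ) ≠ 0 := by
    exact_mod_cast (Complex.normSq_pos.2 hd0).ne'
  push_cast
  rw [← h3]
  have : conj d ≠ 0 := by simpa using hd0
  rw [Complex.normSq_eq_conj_mul_self]
  field_simp
  ring

theorem exists_isCircle_of_im_ne_zero {s₁ s₂ ν : ℂ} (hs : s₁ ≠ s₂) (hν : ν.im ≠ 0) :
    ∃ T, IsCircle T ∧ ∀ a b : ℂ, (a ≠ 0 ∨ b ≠ 0) →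
      (ν * ((a - s₁ * b) * conj (a - s₂ * b))).im = 0 → ofCoords a b ∈ T := by
  set d : ℂ := (s₁ - s₂) / 2 with hd
  have hd0 : d ≠ 0 := div_ne_zero (sub_ne_zero.2 hs) two_ne_zero
  set m : ℂ := (s₁ + s₂) / 2 with hm
  set κ : ℝ := ν.re / ν.im with hκ
  -- The locus of the equation is the circle through `s₁` and `s₂` with this centre.
  refine ⟨_, Or.inl ⟨m - κ * Complex.I * d, √(Complex.normSq d * (1 + κ ^ 2)), ?_, rfl⟩, ?_⟩
  · have := Complex.normSq_pos.2 hd0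
    positivity
  intro a b hab h
  have hb : b ≠ 0 := by
    rintro rfl
    have ha : a ≠ 0 := by simpa using hab
    rw [mul_zero, mul_zero, sub_zero, ← Complex.normSq_eq_conj_mul_self (z := a) |>.trans
      (mul_comm _ _), Complex.im_mul_ofReal] at h
    exact (mul_ne_zero hν (Complex.normSq_pos.2 ha).ne') h
  rw [ofCoords, if_neg hb]
  refine ⟨_, ?_, rfl⟩
  set w := a / b with hw
  have haw : a = w * b := by rw [hw, div_mul_cancel₀ _ hb]
  have h1 : (ν * ((w - s₁) * conj (w - s₂))).im = 0 := by
    have e : ν * ((a - s₁ * b) * conj (a - s₂ * b)) =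
        (Complex.normSq b : ℂ) * (ν * ((w - s₁) * conj (w - s₂))) := by
      rw [Complex.normSq_eq_conj_mul_self, haw, map_sub, map_mul, map_mul, map_sub]
      ring
    rw [e, Complex.im_ofReal_mul] at h
    exact (mul_eq_zero.1 h).resolve_left (Complex.normSq_pos.2 hb).ne'
  have hs1 : s₁ = m + d := by rw [hm, hd]; ring
  have hs2 : s₂ = m - d := by rw [hm, hd]; ring
  have hνre : ν.re = κ * ν.im := by rw [hκ, div_mul_cancel₀ _ hν]
  rw [mem_sphere_iff_norm, ← Real.sqrt_sq (norm_nonneg _), ← Complex.normSq_eq_norm_sq]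
  congr 1
  rw [hs1, hs2] at h1
  clear_value w m d κ
  simp only [Complex.mul_im, Complex.mul_re, Complex.sub_re, Complex.sub_im, Complex.conj_re,
    Complex.conj_im, Complex.add_re, Complex.add_im, hνre] at h1
  have h2 : ν.im * (κ * ((w.re - (m.re + d.re)) * -(w.im - (m.im - d.im)) +
      (w.im - (m.im + d.im)) * (w.re - (m.re - d.re))) +
      ((w.re - (m.re + d.re)) * (w.re - (m.re - d.re)) -
        (w.im - (m.im + d.im)) * -(w.im - (m.im - d.im)))) = 0 := by
    linear_combination h1
  have h3 := (mul_eq_zero.1 h2).resolve_left hν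
  simp only [Complex.normSq_apply, Complex.mul_im, Complex.mul_re, Complex.sub_re, Complex.sub_im,
    Complex.I_re, Complex.I_im, Complex.ofReal_re, Complex.ofReal_im]
  linear_combination h3

/-- If the Möbius transformation `μ₁ (w - s₁) / (μ₂ (w - s₂))` is real at `w = [a : b]`, then `w`
lies on a circle not depending on `w`. -/
theorem exists_isCircle {s₁ s₂ μ₁ μ₂ : ℂ} (hs : s₁ ≠ s₂) (h₁ : μ₁ ≠ 0) (h₂ : μ₂ ≠ 0) :
    ∃ T, IsCircle T ∧ ∀ a b : ℂ, (a ≠ 0 ∨ b ≠ 0) →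
      conj (μ₁ * (a - s₁ * b)) = μ₁ * (a - s₁ * b) →
      conj (μ₂ * (a - s₂ * b)) = μ₂ * (a - s₂ * b) → ofCoords a b ∈ T := by
  have key : ∀ a b : ℂ, conj (μ₁ * (a - s₁ * b)) = μ₁ * (a - s₁ * b) →
      conj (μ₂ * (a - s₂ * b)) = μ₂ * (a - s₂ * b) →
      (μ₁ * conj μ₂ * ((a - s₁ * b) * conj (a - s₂ * b))).im = 0 := by
    intro a b ha hb
    have e : μ₁ * conj μ₂ * ((a - s₁ * b) * conj (a - s₂ * b)) =
        (μ₁ * (a - s₁ * b)) * conj (μ₂ * (a - s₂ * b)) := by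
      rw [map_mul]
      ring
    rw [← Complex.conj_eq_iff_im, e, map_mul, Complex.conj_conj, ha, ← hb, Complex.conj_conj, hb]
  by_cases hν : (μ₁ * conj μ₂).im = 0
  · obtain ⟨T, hT, h⟩ := exists_isCircle_of_im_eq_zero hs (mul_ne_zero h₁ (by simpa using h₂)) hν
    exact ⟨T, hT, fun a b _ ha hb => h a b (key a b ha hb)⟩
  · obtain ⟨T, hT, h⟩ := exists_isCircle_of_im_ne_zero hs hν
    exact ⟨T, hT, fun a b hab ha hb => h a b hab (key a b ha hb)⟩

/-! ### Values of rational functions in homogeneous coordinates -/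

/-- The degree of the map induced by `f`, in which numerator and denominator are homogenised. -/
noncomputable def deg (f : RatFunc ℂ) : ℕ := max f.num.natDegree f.denom.natDegree

theorem natDegree_num_le_deg (f : RatFunc ℂ) : f.num.natDegree ≤ deg f := le_max_left _ _

theorem natDegree_denom_le_deg (f : RatFunc ℂ) : f.denom.natDegree ≤ deg f := le_max_right _ _

theorem toSphere_coe (g : RatFunc ℂ) (z : ℂ) :
    toSphere g (z : OnePoint ℂ) = ofCoords (g.num.eval z) (g.denom.eval z) := rfl

theorem toSphere_infty (g : RatFunc ℂ) :
    toSphere g ∞ = ofCoords (g.num.coeff (deg g)) (g.denom.coeff (deg g)) := by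
  change (if _ then _ else _) = _
  unfold ofCoords deg
  by_cases h : g.denom.natDegree < g.num.natDegree
  · rw [if_pos h, max_eq_left h.le, if_pos (coeff_eq_zero_of_natDegree_lt h)]
  · rw [if_neg h, max_eq_right (not_lt.1 h), if_neg]
    · rfl
    · exact leadingCoeff_ne_zero.2 g.denom_ne_zero

theorem coeff_max_ne_zero {P Q : ℂ[X]} (hQ : Q ≠ 0) :
    P.coeff (max P.natDegree Q.natDegree) ≠ 0 ∨ Q.coeff (max P.natDegree Q.natDegree) ≠ 0 := by
  rcases lt_or_ge Q.natDegree P.natDegree with h | h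
  · left
    rw [max_eq_left h.le]
    exact leadingCoeff_ne_zero.2 (by rintro rfl; simp at h)
  · right
    rw [max_eq_right h]
    exact leadingCoeff_ne_zero.2 hQ

theorem coeff_deg_ne_zero (g : RatFunc ℂ) :
    g.num.coeff (deg g) ≠ 0 ∨ g.denom.coeff (deg g) ≠ 0 := coeff_max_ne_zero g.denom_ne_zero

theorem eval_ne_zero_or {P Q : ℂ[X]} (h : IsCoprime P Q) (z : ℂ) :
    P.eval z ≠ 0 ∨ Q.eval z ≠ 0 := by
  by_contra! h'
  exact not_isRoot_of_isCoprime h h'.1 h'.2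

theorem num_mul_eq_of_eq_div {g : RatFunc ℂ} {P Q : ℂ[X]} (hQ : Q ≠ 0)
    (hg : g = algebraMap ℂ[X] (RatFunc ℂ) P / algebraMap ℂ[X] (RatFunc ℂ) Q) :
    g.num * Q = P * g.denom := by
  rw [RatFunc.num_mul_eq_mul_denom_iff hQ, hg]

theorem toSphere_coe_of_eq_div {g : RatFunc ℂ} {P Q : ℂ[X]} (hQ : Q ≠ 0)
    (hg : g = algebraMap ℂ[X] (RatFunc ℂ) P / algebraMap ℂ[X] (RatFunc ℂ) Q)
    (z : ℂ) (h : P.eval z ≠ 0 ∨ Q.eval z ≠ 0) :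
    toSphere g (z : OnePoint ℂ) = ofCoords (P.eval z) (Q.eval z) := by
  rw [toSphere_coe, ofCoords_eq_iff (eval_ne_zero_or g.isCoprime_num_denom z) h, ← eval_mul,
    num_mul_eq_of_eq_div hQ hg, eval_mul]

theorem toSphere_infty_of_eq_div {g : RatFunc ℂ} {P Q : ℂ[X]} (hQ : Q ≠ 0)
    (hg : g = algebraMap ℂ[X] (RatFunc ℂ) P / algebraMap ℂ[X] (RatFunc ℂ) Q)
    {n : ℕ} (hPn : P.natDegree ≤ n) (hQn : Q.natDegree ≤ n)
    (h : P.coeff n ≠ 0 ∨ Q.coeff n ≠ 0) :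
    toSphere g ∞ = ofCoords (P.coeff n) (Q.coeff n) := by
  rw [toSphere_infty, ofCoords_eq_iff (coeff_deg_ne_zero g) h,
    ← coeff_mul_add_eq_of_natDegree_le (natDegree_num_le_deg g) hQn, num_mul_eq_of_eq_div hQ hg,
    add_comm, coeff_mul_add_eq_of_natDegree_le hPn (natDegree_denom_le_deg g)]

/-! ### Composition -/

/-- The value at `(a, b)` of the homogenisation of degree `m` of the polynomial `P`, which is
meant to have degree at most `m`. -/
noncomputable def homEval {A : Type*} [CommRing A] [Algebra ℂ A] (m : ℕ) (P : ℂ[X]) (a b : A) : A :=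
  ∑ i ∈ Finset.range (m + 1), algebraMap ℂ A (P.coeff i) * (a ^ i * b ^ (m - i))

theorem map_homEval {A B : Type*} [CommRing A] [Algebra ℂ A] [CommRing B] [Algebra ℂ B]
    (φ : A →ₐ[ℂ] B) (m : ℕ) (P : ℂ[X]) (a b : A) :
    φ (homEval m P a b) = homEval m P (φ a) (φ b) := by
  simp [homEval]

theorem homEval_eq {A : Type*} [Field A] [Algebra ℂ A] {m : ℕ} {P : ℂ[X]} (hP : P.natDegree ≤ m)
    (a : A) {b : A} (hb : b ≠ 0) : homEval m P a b = b ^ m * aeval (a / b) P := by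
  rw [aeval_eq_sum_range' (Nat.lt_succ_of_le hP), Finset.mul_sum]
  refine Finset.sum_congr rfl fun i hi => ?_
  have hi : i ≤ m := Nat.lt_succ_iff.1 (Finset.mem_range.1 hi)
  have : b ^ m = b ^ (m - i) * b ^ i := by rw [← pow_add, Nat.sub_add_cancel hi]
  rw [Algebra.smul_def, div_pow, this]
  field_simp

theorem homEval_zero (m : ℕ) (P : ℂ[X]) (a : ℂ) : homEval m P a 0 = P.coeff m * a ^ m := by
  rw [homEval, Finset.sum_range_succ, Finset.sum_eq_zero]
  · simp
  · intro i hi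
    rw [zero_pow (by have := Finset.mem_range.1 hi; omega)]
    simp

theorem natDegree_pow_mul_pow_le {n m i : ℕ} {N D : ℂ[X]} (hN : N.natDegree ≤ n)
    (hD : D.natDegree ≤ n) (hi : i ≤ m) : (N ^ i * D ^ (m - i)).natDegree ≤ m * n := by
  refine (natDegree_mul_le_of_le (natDegree_pow_le_of_le i hN)
    (natDegree_pow_le_of_le (m - i) hD)).trans ?_
  rw [← add_mul, Nat.add_sub_cancel' hi]

theorem natDegree_homEval_le {n m : ℕ} {N D : ℂ[X]} (hN : N.natDegree ≤ n)
    (hD : D.natDegree ≤ n) (P : ℂ[X]) : (homEval m P N D).natDegree ≤ m * n := by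
  refine natDegree_sum_le_of_forall_le _ _ fun i hi => ?_
  have hi : i ≤ m := Nat.lt_succ_iff.1 (Finset.mem_range.1 hi)
  rw [algebraMap_eq]
  exact (natDegree_C_mul_le _ _).trans (natDegree_pow_mul_pow_le hN hD hi)

theorem coeff_homEval {n m : ℕ} {N D : ℂ[X]} (hN : N.natDegree ≤ n)
    (hD : D.natDegree ≤ n) (P : ℂ[X]) :
    (homEval m P N D).coeff (m * n) = homEval m P (N.coeff n) (D.coeff n) := by
  rw [homEval, finsetSum_coeff]
  refine Finset.sum_congr rfl fun i hi => ?_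
  have hi : i ≤ m := Nat.lt_succ_iff.1 (Finset.mem_range.1 hi)
  have : m * n = i * n + (m - i) * n := by rw [← add_mul, Nat.add_sub_cancel' hi]
  rw [algebraMap_eq, coeff_C_mul, this,
    coeff_mul_add_eq_of_natDegree_le (natDegree_pow_le_of_le i hN)
    (natDegree_pow_le_of_le (m - i) hD), coeff_pow_of_natDegree_le hN,
    coeff_pow_of_natDegree_le hD]
  rfl

theorem homEval_ne_zero_or (f : RatFunc ℂ) {a b : ℂ} (h : a ≠ 0 ∨ b ≠ 0) :
    homEval (deg f) f.num a b ≠ 0 ∨ homEval (deg f) f.denom a b ≠ 0 := by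
  by_cases hb : b = 0
  · subst hb
    have ha : a ≠ 0 := by simpa using h
    rw [homEval_zero, homEval_zero]
    exact (coeff_deg_ne_zero f).imp (fun h => mul_ne_zero h (pow_ne_zero _ ha))
      fun h => mul_ne_zero h (pow_ne_zero _ ha)
  · rw [homEval_eq (natDegree_num_le_deg f) a hb, homEval_eq (natDegree_denom_le_deg f) a hb]
    exact (eval_ne_zero_or f.isCoprime_num_denom (a / b)).imp
      (fun h => mul_ne_zero (pow_ne_zero _ hb) h) fun h => mul_ne_zero (pow_ne_zero _ hb) h

theorem toSphere_ofCoords (f : RatFunc ℂ) {a b : ℂ} (h : a ≠ 0 ∨ b ≠ 0) :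
    toSphere f (ofCoords a b) =
      ofCoords (homEval (deg f) f.num a b) (homEval (deg f) f.denom a b) := by
  have hne := homEval_ne_zero_or f h
  by_cases hb : b = 0
  · subst hb
    rw [homEval_zero, homEval_zero] at *
    rw [ofCoords, if_pos rfl, toSphere_infty,
      ofCoords_eq_iff (coeff_deg_ne_zero f) hne]
    ring
  · rw [homEval_eq (natDegree_num_le_deg f) a hb, homEval_eq (natDegree_denom_le_deg f) a hb] at *
    rw [ofCoords, if_neg hb, toSphere_coe,
      ofCoords_eq_iff (eval_ne_zero_or f.isCoprime_num_denom _) hne, coe_aeval_eq_eval]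
    ring

theorem linearIndependent_num_denom {g : RatFunc ℂ} (hg : ¬ IsConstant g) :
    LinearIndependent ℂ ![g.num, g.denom] := by
  rw [LinearIndependent.pair_iff]
  intro s t h
  rw [smul_eq_C_mul, smul_eq_C_mul] at h
  by_cases hs : s = 0
  · subst hs
    have : C t = 0 := by simpa [g.denom_ne_zero] using h
    exact ⟨rfl, by simpa using this⟩
  · refine absurd ⟨-t / s, ?_⟩ hg
    rw [← RatFunc.num_div_denom g, div_eq_iff (by simpa using g.denom_ne_zero),
      ← RatFunc.algebraMap_C, ← map_mul]
    congr 1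
    have h2 : C s * g.num = C s * (C (-t / s) * g.denom) := by
      rw [← mul_assoc, ← C_mul, mul_div_cancel₀ _ hs, C_neg]
      linear_combination h
    exact mul_left_cancel₀ (by simpa using hs) h2

/-- A polynomial vanishing at all finite values of a non-constant rational function is zero, because
fibres of the function are finite. -/
theorem eq_zero_of_eval_values_eq_zero {g : RatFunc ℂ} (hg : ¬ IsConstant g) (P : ℂ[X])
    (hP : ∀ z, g.denom.eval z ≠ 0 → P.eval (g.num.eval z / g.denom.eval z) = 0) : P = 0 := by
  by_contra hP0
  have hcover : (Set.univ : Set ℂ) ⊆ {z | g.denom.eval z = 0} ∪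
      ⋃ r ∈ {r | P.IsRoot r}, {z | g.num.eval z = r * g.denom.eval z} := by
    intro z _
    by_cases hz : g.denom.eval z = 0
    · exact Or.inl hz
    · refine Or.inr (Set.mem_biUnion (hP z hz) ?_)
      exact (div_mul_cancel₀ _ hz).symm
  refine Set.infinite_univ (Set.Finite.subset ?_ hcover)
  refine Set.Finite.union (finite_setOfPred_isRoot g.denom_ne_zero) ?_
  exact (finite_setOfPred_isRoot hP0).biUnion fun r _ =>
    finite_fibre (linearIndependent_num_denom hg) r

theorem homEval_num_denom_ne_zero {g : RatFunc ℂ} (hg : ¬ IsConstant g) {m : ℕ} {P : ℂ[X]}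
    (hP0 : P ≠ 0) (hP : P.natDegree ≤ m) : homEval m P g.num g.denom ≠ 0 := by
  intro h
  refine hP0 (eq_zero_of_eval_values_eq_zero hg P fun z hz => ?_)
  have h' := congrArg (aeval z) h
  rw [map_homEval, coe_aeval_eq_eval, homEval_eq hP _ hz] at h'
  simpa [hz] using h'

theorem comp_eq_div (f : RatFunc ℂ) (g : RatFunc ℂ) :
    comp f g = algebraMap ℂ[X] (RatFunc ℂ) (homEval (deg f) f.num g.num g.denom) /
      algebraMap ℂ[X] (RatFunc ℂ) (homEval (deg f) f.denom g.num g.denom) := by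
  have hd : algebraMap ℂ[X] (RatFunc ℂ) g.denom ≠ 0 := by simpa using g.denom_ne_zero
  have h := fun P : ℂ[X] => map_homEval (IsScalarTower.toAlgHom ℂ ℂ[X] (RatFunc ℂ)) (deg f) P
    g.num g.denom
  simp only [IsScalarTower.coe_toAlgHom'] at h
  rw [h, h, homEval_eq (natDegree_num_le_deg f) _ hd, homEval_eq (natDegree_denom_le_deg f) _ hd,
    RatFunc.num_div_denom, mul_div_mul_left _ _ (pow_ne_zero _ hd)]
  rfl

/-- `toSphere` turns composition of rational functions into composition of maps. At `∞` the
coefficients in degree `deg f * deg g` of the homogenised numerator and denominator are used. -/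
theorem toSphere_comp (f : RatFunc ℂ) {g : RatFunc ℂ} (hg : ¬ IsConstant g) (P : OnePoint ℂ) :
    toSphere (comp f g) P = toSphere f (toSphere g P) := by
  have h0 := homEval_num_denom_ne_zero hg f.denom_ne_zero (natDegree_denom_le_deg f)
  induction P using OnePoint.rec with
  | infty =>
    have h := homEval_ne_zero_or f (coeff_deg_ne_zero g)
    have hc := fun P => coeff_homEval (m := deg f) (natDegree_num_le_deg g)
      (natDegree_denom_le_deg g) P
    rw [toSphere_infty g, toSphere_ofCoords f (coeff_deg_ne_zero g), ← hc, ← hc]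
    rw [← hc, ← hc] at h
    exact toSphere_infty_of_eq_div h0 (comp_eq_div f g)
      (natDegree_homEval_le (natDegree_num_le_deg g) (natDegree_denom_le_deg g) _)
      (natDegree_homEval_le (natDegree_num_le_deg g) (natDegree_denom_le_deg g) _) h
  | coe z =>
    have hcop := eval_ne_zero_or g.isCoprime_num_denom z
    have h := homEval_ne_zero_or f hcop
    have he := fun P => map_homEval (aeval z) (deg f) P g.num g.denom
    simp only [coe_aeval_eq_eval] at he
    rw [toSphere_coe g, toSphere_ofCoords f hcop, ← he, ← he]
    rw [← he, ← he] at h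
    exact toSphere_coe_of_eq_div h0 (comp_eq_div f g) z h

/-! ### Surjectivity on the extended real line -/

/-- A continuous function on the circle `ℝ ∪ {∞}` that takes its value at `z` only once has a strict
extremum at `z`, and so is not injective near `z`. -/
theorem exists_eq_near_extremum {ψ : ℝ → ℝ} (hψ : Continuous ψ) {z L : ℝ}
    (htop : Tendsto ψ atTop (𝓝 L)) (hbot : Tendsto ψ atBot (𝓝 L)) (hL : L ≠ ψ z)
    (hz : ∀ y, ψ y = ψ z → y = z) {ε : ℝ} (hε : 0 < ε) :
    ∃ y₁ y₂, z - ε < y₁ ∧ y₁ < z ∧ z < y₂ ∧ y₂ < z + ε ∧ ψ y₁ = ψ y₂ := by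
  wlog hlt : ψ z < L generalizing ψ L with H
  · obtain ⟨y₁, y₂, h1, h2, h3, h4, h5⟩ := H (ψ := fun y => -ψ y) (L := -L) hψ.neg htop.neg
      hbot.neg (by simpa using hL) (by simpa using hz)
      (neg_lt_neg (lt_of_le_of_ne (not_lt.1 hlt) hL))
    exact ⟨y₁, y₂, h1, h2, h3, h4, neg_injective h5⟩
  have hpos : ∀ y, y ≠ z → ψ z < ψ y := by
    intro y hy
    by_contra! hle
    rcases lt_or_gt_of_ne hy with h | h
    · obtain ⟨Y, hY1, hY2⟩ :=
        ((hbot.eventually (lt_mem_nhds hlt)).and (eventually_le_atBot y)).exists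
      obtain ⟨w, hw, hw'⟩ := intermediate_value_Icc' hY2 hψ.continuousOn ⟨hle, hY1.le⟩
      have := hz w hw'
      have := hw.2
      linarith
    · obtain ⟨Y, hY1, hY2⟩ :=
        ((htop.eventually (lt_mem_nhds hlt)).and (eventually_ge_atTop y)).exists
      obtain ⟨w, hw, hw'⟩ := intermediate_value_Icc hY2 hψ.continuousOn ⟨hle, hY1.le⟩
      have := hz w hw'
      have := hw.1
      linarith
  set v := min (ψ (z - ε / 2)) (ψ (z + ε / 2)) with hv
  have hvz : ψ z < v := lt_min (hpos _ (by linarith)) (hpos _ (by linarith))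
  obtain ⟨y₁, hy₁, hy₁'⟩ := intermediate_value_Icc' (by linarith : z - ε / 2 ≤ z)
    hψ.continuousOn ⟨hvz.le, min_le_left _ _⟩
  obtain ⟨y₂, hy₂, hy₂'⟩ := intermediate_value_Icc (by linarith : z ≤ z + ε / 2)
    hψ.continuousOn ⟨hvz.le, min_le_right _ _⟩
  refine ⟨y₁, y₂, by linarith [hy₁.1], lt_of_le_of_ne hy₁.2 ?_, lt_of_le_of_ne hy₂.1 ?_,
    by linarith [hy₂.2], hy₁'.trans hy₂'.symm⟩
  · rintro rfl
    exact hvz.ne hy₁'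
  · rintro rfl
    exact hvz.ne hy₂'

theorem tendsto_div_atTop_atBot {q e : ℝ[X]} (he : e ≠ 0) (hdeg : q.natDegree ≤ e.natDegree) :
    Tendsto (fun y => q.eval y / e.eval y) atTop
      (𝓝 (q.coeff e.natDegree / e.coeff e.natDegree)) ∧
    Tendsto (fun y => q.eval y / e.eval y) atBot
      (𝓝 (q.coeff e.natDegree / e.coeff e.natDegree)) := by
  rcases lt_or_eq_of_le
    ((degree_le_of_natDegree_le hdeg).trans_eq (degree_eq_natDegree he).symm) with h | h
  · rw [coeff_eq_zero_of_degree_lt (by rwa [← degree_eq_natDegree he]), zero_div]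
    exact ⟨div_tendsto_atTop_zero_of_degree_lt _ _ h, div_tendsto_atBot_zero_of_degree_lt _ _ h⟩
  · have hn := natDegree_eq_of_degree_eq h
    have h1 : q.coeff e.natDegree = q.leadingCoeff := by rw [← hn]; rfl
    rw [h1]
    exact ⟨div_tendsto_atTop_leadingCoeff_div_of_degree_eq _ _ h,
      div_tendsto_atBot_leadingCoeff_div_of_degree_eq _ _ h⟩

theorem exists_nhds_injective_of_deriv_ne_zero {A B : ℂ[X]} {z : ℂ} (hB : B.eval z ≠ 0)
    (hd : deriv (fun w => A.eval w / B.eval w) z ≠ 0) :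
    ∃ U ∈ 𝓝 z, ∀ a ∈ U, ∀ b ∈ U, A.eval a * B.eval b = A.eval b * B.eval a → a = b := by
  have hs := (A.hasStrictDerivAt z).fun_div (B.hasStrictDerivAt z) hB
  rw [hs.hasDerivAt.deriv] at hd
  have h1 := (hs.hasStrictFDerivAt_equiv hd).eventually_left_inverse
  have h2 : ∀ᶠ w in 𝓝 z, B.eval w ≠ 0 := B.continuous.continuousAt.eventually_ne hB
  refine ⟨_, h1.and h2, fun a ha b hb hab => ?_⟩
  rw [← ha.1, ← hb.1]
  congr 1
  rw [div_eq_div_iff ha.2 hb.2]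
  exact hab

theorem exists_nhds_injective {g : RatFunc ℂ} {z : ℂ} (hz : ¬ IsCriticalPoint g z) :
    ∃ U ∈ 𝓝 z, ∀ a ∈ U, ∀ b ∈ U,
      toSphere g (a : OnePoint ℂ) = toSphere g (b : OnePoint ℂ) → a = b := by
  have heq : ∀ a b : ℂ, toSphere g (a : OnePoint ℂ) = toSphere g (b : OnePoint ℂ) →
      g.num.eval a * g.denom.eval b = g.num.eval b * g.denom.eval a := fun a b h => by
    rwa [toSphere_coe, toSphere_coe, ofCoords_eq_iff (eval_ne_zero_or g.isCoprime_num_denom _)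
      (eval_ne_zero_or g.isCoprime_num_denom _)] at h
  unfold IsCriticalPoint at hz
  split_ifs at hz with hD
  · have hN := (eval_ne_zero_or g.isCoprime_num_denom z).resolve_right (not_not.2 hD)
    obtain ⟨U, hU, h⟩ := exists_nhds_injective_of_deriv_ne_zero hN hz
    exact ⟨U, hU, fun a ha b hb hab => h a ha b hb (by linear_combination -(heq a b hab))⟩
  · obtain ⟨U, hU, h⟩ := exists_nhds_injective_of_deriv_ne_zero hD hz
    exact ⟨U, hU, fun a ha b hb hab => h a ha b hb (heq a b hab)⟩

theorem coe_mem_extendedReals (r : ℝ) : ((r : ℂ) : OnePoint ℂ) ∈ extendedReals :=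
  ⟨(r : OnePoint ℝ), rfl⟩

theorem infty_mem_extendedReals : ∞ ∈ extendedReals := ⟨∞, rfl⟩

theorem eq_of_mem_extendedReals {y : OnePoint ℂ} (hy : y ∈ extendedReals) :
    y = ∞ ∨ ∃ r : ℝ, y = ((r : ℂ) : OnePoint ℂ) := by
  obtain ⟨r, rfl⟩ := hy
  induction r using OnePoint.rec with
  | infty => exact Or.inl rfl
  | coe r => exact Or.inr ⟨r, rfl⟩

theorem ofCoords_mem_extendedReals (a b : ℝ) : ofCoords a b ∈ extendedReals := by
  unfold ofCoords
  split_ifs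
  · exact infty_mem_extendedReals
  · exact_mod_cast coe_mem_extendedReals (a / b)

/-- The rational function `h` is the quotient of the coprime real polynomials `p` and `q`. -/
structure IsReducedRealQuotient (h : RatFunc ℂ) (p q : ℝ[X]) : Prop where
  isCoprime : IsCoprime p q
  denom_ne_zero : q ≠ 0
  eq_div : h = algebraMap ℂ[X] (RatFunc ℂ) (p.map Complex.ofRealHom) /
    algebraMap ℂ[X] (RatFunc ℂ) (q.map Complex.ofRealHom)

theorem IsReal.exists_isReducedRealQuotient {h : RatFunc ℂ} (hh : IsReal h) :
    ∃ p q : ℝ[X], IsReducedRealQuotient h p q := by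
  obtain ⟨p, q, hq, rfl⟩ := hh
  obtain ⟨d, p', q', hd, hcop, rfl, rfl⟩ : ∃ d p' q' : ℝ[X], d ≠ 0 ∧ IsCoprime p' q' ∧
      p = d * p' ∧ q = d * q' := by
    classical
    let _ := EuclideanDomain.gcdMonoid ℝ[X]
    exact ⟨_, _, _, gcd_ne_zero_of_right hq, isCoprime_div_gcd_div_gcd hq,
      (EuclideanDomain.mul_div_cancel' (gcd_ne_zero_of_right hq) (gcd_dvd_left p q)).symm,
      (EuclideanDomain.mul_div_cancel' (gcd_ne_zero_of_right hq) (gcd_dvd_right p q)).symm⟩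
  refine ⟨p', q', hcop, right_ne_zero_of_mul hq, ?_⟩
  rw [Polynomial.map_mul, Polynomial.map_mul, map_mul, map_mul, mul_div_mul_left]
  simpa [Polynomial.map_eq_zero] using hd

theorem toSphere_coe_of_real {h : RatFunc ℂ} {p q : ℝ[X]}
    (hh : IsReducedRealQuotient h p q) (z : ℂ) : toSphere h (z : OnePoint ℂ) =
    ofCoords ((p.map Complex.ofRealHom).eval z) ((q.map Complex.ofRealHom).eval z) :=
  toSphere_coe_of_eq_div (by simpa [Polynomial.map_eq_zero] using hh.denom_ne_zero) hh.eq_div z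
    (eval_ne_zero_or (hh.isCoprime.map (mapRingHom Complex.ofRealHom)) z)

theorem toSphere_ofReal {h : RatFunc ℂ} {p q : ℝ[X]}
    (hh : IsReducedRealQuotient h p q) (r : ℝ) : toSphere h ((r : ℂ) : OnePoint ℂ) =
    ofCoords (p.eval r : ℝ) (q.eval r : ℝ) := by
  rw [toSphere_coe_of_real hh]
  have : ∀ s : ℝ[X], (s.map Complex.ofRealHom).eval (r : ℂ) = (s.eval r : ℝ) := fun s =>
    eval_map_apply (f := Complex.ofRealHom) (p := s) r
  rw [this, this]

theorem toSphere_infty_of_real {h : RatFunc ℂ} {p q : ℝ[X]}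
    (hh : IsReducedRealQuotient h p q) : toSphere h ∞ =
    ofCoords (p.coeff (max p.natDegree q.natDegree) : ℝ)
      (q.coeff (max p.natDegree q.natDegree) : ℝ) := by
  have hq0 : q.map Complex.ofRealHom ≠ 0 := by simpa [Polynomial.map_eq_zero] using hh.denom_ne_zero
  have h1 := coeff_max_ne_zero (P := p.map Complex.ofRealHom) hq0
  rw [natDegree_map, natDegree_map] at h1
  rw [toSphere_infty_of_eq_div hq0 hh.eq_div (by rw [natDegree_map]; exact le_max_left _ _)
    (by rw [natDegree_map]; exact le_max_right _ _) h1, coeff_map, coeff_map]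
  rfl

theorem toSphere_mem_extendedReals {h : RatFunc ℂ} {p q : ℝ[X]}
    (hh : IsReducedRealQuotient h p q) {y : OnePoint ℂ} (hy : y ∈ extendedReals) :
    toSphere h y ∈ extendedReals := by
  rcases eq_of_mem_extendedReals hy with rfl | ⟨r, rfl⟩
  · rw [toSphere_infty_of_real hh]
    exact ofCoords_mem_extendedReals _ _
  · rw [toSphere_ofReal hh]
    exact ofCoords_mem_extendedReals _ _

/-- A real rational function that is injective on the real line near `z` and takes its value at `z`
only once on the extended real line takes every real value `t` there. Otherwise `q / (p - t * q)`,
which is `1 / (h - t)`, would be a continuous real function on the extended real line contradicting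
`exists_eq_near_extremum`. -/
theorem exists_toSphere_eq_coe {h : RatFunc ℂ} {p q : ℝ[X]}
    (hh : IsReducedRealQuotient h p q) {z : ℝ} {U : Set ℂ} (hU : U ∈ 𝓝 (z : ℂ))
    (hinj : ∀ a b : ℝ, (a : ℂ) ∈ U → (b : ℂ) ∈ U →
      toSphere h ((a : ℂ) : OnePoint ℂ) = toSphere h ((b : ℂ) : OnePoint ℂ) → a = b)
    (huniq : ∀ y ∈ extendedReals, toSphere h y = toSphere h ((z : ℂ) : OnePoint ℂ) →
      y = ((z : ℂ) : OnePoint ℂ)) (t : ℝ) :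
    ∃ y ∈ extendedReals, toSphere h y = ((t : ℂ) : OnePoint ℂ) := by
  by_contra! hno
  set n := max p.natDegree q.natDegree with hn
  set e : ℝ[X] := p - C t * q with he
  have hcoords : ∀ a b : ℝ, (a ≠ 0 ∨ b ≠ 0) → a - t * b = 0 →
      ofCoords a b = ((t : ℂ) : OnePoint ℂ) := by
    intro a b hab h0
    have hat : a = t * b := sub_eq_zero.1 h0
    have hb : b ≠ 0 := by
      rintro rfl
      simp_all
    have : (b : ℂ) ≠ 0 := by exact_mod_cast hb
    rw [ofCoords, if_neg this, hat]
    push_cast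
    rw [mul_div_cancel_right₀ _ this]
  have hpq' : ∀ r : ℝ, p.eval r ≠ 0 ∨ q.eval r ≠ 0 := by
    intro r
    by_contra! h0
    obtain ⟨a, b, hab⟩ := hh.isCoprime
    simpa [h0.1, h0.2] using congrArg (Polynomial.eval r) hab
  have hpqn : p.coeff n ≠ 0 ∨ q.coeff n ≠ 0 := by
    have := coeff_max_ne_zero (P := p.map Complex.ofRealHom) (Q := q.map Complex.ofRealHom)
      (by simpa [Polynomial.map_eq_zero] using hh.denom_ne_zero)
    simpa [natDegree_map, ← hn] using this
  have heval : ∀ r, e.eval r ≠ 0 := by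
    intro r hr
    refine hno _ (coe_mem_extendedReals r) ?_
    rw [toSphere_ofReal hh, hcoords _ _ (hpq' r)]
    simpa [he] using hr
  have hen : e.coeff n ≠ 0 := by
    intro hr
    refine hno _ infty_mem_extendedReals ?_
    rw [toSphere_infty_of_real hh, hcoords _ _ hpqn]
    simpa [he] using hr
  have hen' : e.natDegree = n := by
    refine le_antisymm ?_ (le_natDegree_of_ne_zero hen)
    refine (natDegree_sub_le _ _).trans (max_le (le_max_left _ _) ?_)
    exact (natDegree_C_mul_le _ _).trans (le_max_right _ _)
  have he0 : e ≠ 0 := fun h0 => heval 0 (by rw [h0, eval_zero])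
  obtain ⟨htop, hbot⟩ := tendsto_div_atTop_atBot (q := q) he0 (by rw [hen']; exact le_max_right _ _)
  rw [hen'] at htop hbot
  have hor : ∀ {a b : ℝ}, (a ≠ 0 ∨ b ≠ 0) → ((a : ℂ) ≠ 0 ∨ (b : ℂ) ≠ 0) := fun h =>
    h.imp (fun h => by exact_mod_cast h) fun h => by exact_mod_cast h
  have hval : ∀ {a b c d : ℝ}, (a ≠ 0 ∨ b ≠ 0) → (c ≠ 0 ∨ d ≠ 0) → a - t * b ≠ 0 →
      c - t * d ≠ 0 → b / (a - t * b) = d / (c - t * d) → ofCoords a b = ofCoords c d := by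
    intro a b c d hab hcd h1 h2 h3
    rw [ofCoords_eq_iff (hor hab) (hor hcd)]
    rw [div_eq_div_iff h1 h2] at h3
    exact_mod_cast (by linear_combination -h3 : a * d = c * b)
  have hee : ∀ r, e.eval r = p.eval r - t * q.eval r := fun r => by simp [he]
  have hec : e.coeff n = p.coeff n - t * q.coeff n := by simp [he]
  have hψ : ∀ r s : ℝ, q.eval r / e.eval r = q.eval s / e.eval s →
      toSphere h ((r : ℂ) : OnePoint ℂ) = toSphere h ((s : ℂ) : OnePoint ℂ) := by
    intro r s hrs
    rw [toSphere_ofReal hh, toSphere_ofReal hh]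
    refine hval (hpq' r) (hpq' s) ?_ ?_ ?_
    · rw [← hee]; exact heval r
    · rw [← hee]; exact heval s
    · rw [← hee, ← hee]; exact hrs
  have hUr : ((↑) : ℝ → ℂ) ⁻¹' U ∈ 𝓝 z := Complex.continuous_ofReal.continuousAt hU
  obtain ⟨ε, hε, hball⟩ := Metric.mem_nhds_iff.1 hUr
  have hL : q.coeff n / e.coeff n ≠ q.eval z / e.eval z := by
    intro h0
    refine OnePoint.infty_ne_coe (z : ℂ) (huniq ∞ infty_mem_extendedReals ?_)
    rw [toSphere_infty_of_real hh, toSphere_ofReal hh]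
    refine hval hpqn (hpq' z) ?_ ?_ ?_
    · rw [← hec]; exact hen
    · rw [← hee]; exact heval z
    · rw [← hec, ← hee]; exact h0
  have hz : ∀ y, q.eval y / e.eval y = q.eval z / e.eval z → y = z := by
    intro y hy
    have := huniq _ (coe_mem_extendedReals y) (hψ _ _ hy)
    exact_mod_cast this
  obtain ⟨y₁, y₂, h1, h2, h3, h4, h5⟩ := exists_eq_near_extremum
    (ψ := fun y => q.eval y / e.eval y) (q.continuous.div e.continuous heval) htop hbot hL hz hε
  have hmem : ∀ y : ℝ, z - ε < y → y < z + ε → (y : ℂ) ∈ U := fun y hy hy' => hball (by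
    rw [Metric.mem_ball, Real.dist_eq, abs_lt]
    constructor <;> linarith)
  have := hinj y₁ y₂ (hmem _ h1 (by linarith)) (hmem _ (by linarith) h4) (hψ _ _ h5)
  linarith

/-! ### Containment of the curve in a circle -/

/-- If all fibres of `g` through generic real points are stable under complex conjugation, then the
quotient of two real members of the pencil spanned by `g.num` and `g.denom` is a Möbius
transformation of `g` that is real on the real line, and the curve lies on a circle. -/
theorem exists_isCircle_of_conj_mem_fibre {k : Subfield ℂ} (hk : IsSmall k) {g : RatFunc ℂ}
    (hg : ¬ IsConstant g) (hN : ∀ n, g.num.coeff n ∈ k) (hD : ∀ n, g.denom.coeff n ∈ k)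
    (hconj : ∀ x : ℝ, (x : ℂ) ∉ k → ∀ y,
      g.num.eval y * g.denom.eval (x : ℂ) = g.num.eval (x : ℂ) * g.denom.eval y →
      g.num.eval (conj y) * g.denom.eval (x : ℂ) = g.num.eval (x : ℂ) * g.denom.eval (conj y)) :
    ∃ T, IsCircle T ∧ curve g ⊆ T := by
  have hlin := linearIndependent_num_denom hg
  have hkr : {r : ℝ | (r : ℂ) ∈ k}.Countable := hk.countable.preimage Complex.ofReal_injective
  have hex : ∀ S : Set ℝ, S.Countable → ∃ r, r ∉ S := fun S hS => by
    by_contra! hS'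
    exact Cardinal.not_countable_real (hS.mono fun r _ => hS' r)
  obtain ⟨x₁, hx₁⟩ := hex _ hkr
  obtain ⟨x₂, hx₂⟩ := hex _ (hkr.union (((finite_fibre hlin
    (g.num.eval (x₁ : ℂ) / g.denom.eval (x₁ : ℂ))).countable.preimage Complex.ofReal_injective)))
  have hx₁ : (x₁ : ℂ) ∉ k := hx₁
  have hx₂k : (x₂ : ℂ) ∉ k := fun h => hx₂ (Or.inl h)
  obtain ⟨μ₁, hμ₁, h₁⟩ := hk.exists_real_pencil_member hN hD g.isCoprime_num_denom hlin hx₁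
    (hconj x₁ hx₁)
  obtain ⟨μ₂, hμ₂, h₂⟩ := hk.exists_real_pencil_member hN hD g.isCoprime_num_denom hlin hx₂k
    (hconj x₂ hx₂k)
  have hD₂ := hk.eval_ne_zero g.denom_ne_zero hD hx₂k
  set s₁ := g.num.eval (x₁ : ℂ) / g.denom.eval (x₁ : ℂ)
  set s₂ := g.num.eval (x₂ : ℂ) / g.denom.eval (x₂ : ℂ) with hs₂
  have hs : s₁ ≠ s₂ := by
    intro hs
    refine hx₂ (Or.inr ?_)
    change _ = _
    rw [hs, hs₂, div_mul_cancel₀ _ hD₂]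
  obtain ⟨T, hT, hmem⟩ := exists_isCircle hs hμ₁ hμ₂
  have heval : ∀ {μ s : ℂ}, (∀ n, conj (μ * (g.num.coeff n - s * g.denom.coeff n)) =
      μ * (g.num.coeff n - s * g.denom.coeff n)) → ∀ r : ℝ,
      conj (μ * (g.num.eval (r : ℂ) - s * g.denom.eval (r : ℂ))) =
        μ * (g.num.eval (r : ℂ) - s * g.denom.eval (r : ℂ)) := by
    intro μ s h r
    have := conj_eval (C μ * (g.num - C s * g.denom)) (fun n => by simpa using h n) r
    rw [Complex.conj_ofReal] at this
    simpa using this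
  refine ⟨T, hT, ?_⟩
  rintro _ ⟨y, hy, rfl⟩
  rcases eq_of_mem_extendedReals hy with rfl | ⟨r, rfl⟩
  · rw [toSphere_infty]
    exact hmem _ _ (coeff_deg_ne_zero g) (h₁ _) (h₂ _)
  · rw [toSphere_coe]
    exact hmem _ _ (eval_ne_zero_or g.isCoprime_num_denom _) (heval h₁ r) (heval h₂ r)

end RationalCurves

theorem theorem2 (f g : RatFunc ℂ)
    (hf : ¬ RationalCurves.IsConstant f) (hg : ¬ RationalCurves.IsConstant g)
    (hfg : RationalCurves.IsReal (RationalCurves.comp f g))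
    (hinj : RationalCurves.WeaklyInjective g)
    (hcirc : ¬ ∃ S : Set (OnePoint ℂ),
      RationalCurves.IsCircle S ∧ RationalCurves.curve g ⊆ S) :
    Set.MapsTo (RationalCurves.toSphere g ∘ RationalCurves.toSphere f)
        (RationalCurves.curve g) (RationalCurves.curve g) ∧
      ¬ Set.InjOn (RationalCurves.toSphere g ∘ RationalCurves.toSphere f)
        (RationalCurves.curve g) := by
  open RationalCurves Polynomial ComplexConjugate in
  obtain ⟨p, q, hh⟩ := hfg.exists_isReducedRealQuotient
  have hcomp := toSphere_comp f hg
  set h := comp f g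
  have hreal : ∀ y ∈ extendedReals, toSphere h y ∈ extendedReals :=
    fun y hy => toSphere_mem_extendedReals hh hy
  refine ⟨?_, fun hI => hcirc ?_⟩
  · rintro _ ⟨y, hy, rfl⟩
    exact ⟨toSphere h y, hreal y hy, by rw [hcomp]; rfl⟩
  have hgh : ∀ a ∈ extendedReals, ∀ b ∈ extendedReals, toSphere h a = toSphere h b →
      toSphere g a = toSphere g b := by
    intro a ha b hb hab
    refine hI ⟨a, ha, rfl⟩ ⟨b, hb, rfl⟩ ?_
    rw [hcomp, hcomp] at hab
    exact congrArg (toSphere g) hab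
  obtain ⟨z, hz, hzu⟩ := hinj
  obtain ⟨U, hU, hUinj⟩ := exists_nhds_injective hz
  have hsurj := exists_toSphere_eq_coe hh hU
    (fun a b ha hb hab => Complex.ofReal_injective (hUinj _ ha _ hb
      (hgh _ (coe_mem_extendedReals a) _ (coe_mem_extendedReals b) hab)))
    (fun y hy hyz => hzu y hy (hgh _ hy _ (coe_mem_extendedReals z) hyz))
  -- `g` is injective on the image of `h`, which contains all real numbers, so `h` is injective.
  have hhinj : ∀ a b : ℝ,
      toSphere h ((a : ℂ) : OnePoint ℂ) = toSphere h ((b : ℂ) : OnePoint ℂ) → a = b := by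
    intro a b hab
    obtain ⟨a', ha', haa⟩ := hsurj a
    obtain ⟨b', hb', hbb⟩ := hsurj b
    have h1 := hgh _ (coe_mem_extendedReals a) _ (coe_mem_extendedReals b) hab
    have h2 : toSphere g a' = toSphere g b' := by
      refine hI ⟨a', ha', rfl⟩ ⟨b', hb', rfl⟩ ?_
      change toSphere g (toSphere f _) = toSphere g (toSphere f _)
      rw [← hcomp, ← hcomp, haa, hbb, h1]
    have h3 : toSphere h a' = toSphere h b' := by rw [hcomp, hcomp, h2]
    rw [haa, hbb] at h3
    exact_mod_cast h3
  -- The small field has to contain the coefficients of `g` and of `h`.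
  set P : ℂ[X] := p.map Complex.ofRealHom with hP
  set Q : ℂ[X] := q.map Complex.ofRealHom with hQ
  have hPQ : IsCoprime P Q := hh.isCoprime.map (mapRingHom Complex.ofRealHom)
  have hval : ∀ a b : ℂ, toSphere h (a : OnePoint ℂ) = toSphere h (b : OnePoint ℂ) ↔
      P.eval a * Q.eval b = P.eval b * Q.eval a := by
    intro a b
    rw [toSphere_coe_of_real hh, toSphere_coe_of_real hh,
      ofCoords_eq_iff (eval_ne_zero_or hPQ _) (eval_ne_zero_or hPQ _)]
  have hlin : LinearIndependent ℂ ![P, Q] := by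
    rw [LinearIndependent.pair_iff]
    intro s t hst
    have hev : ∀ r : ℂ, s * P.eval r + t * Q.eval r = 0 := fun r => by
      simpa using congrArg (Polynomial.eval r) hst
    have hdet : P.eval 0 * Q.eval 1 - P.eval 1 * Q.eval 0 ≠ 0 := by
      intro h0
      refine zero_ne_one (hhinj 0 1 ((hval _ _).2 ?_))
      push_cast
      exact sub_eq_zero.1 h0
    constructor
    · refine (mul_eq_zero.1 (?_ : s * _ = 0)).resolve_right hdet
      linear_combination Q.eval 1 * hev 0 - Q.eval 0 * hev 1
    · refine (mul_eq_zero.1 (?_ : t * _ = 0)).resolve_right hdet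
      linear_combination P.eval 0 * hev 1 - P.eval 1 * hev 0
  obtain ⟨k, hk, hSk⟩ := exists_isSmall
    ((Set.range g.num.coeff ∪ Set.range g.denom.coeff) ∪ (Set.range P.coeff ∪ Set.range Q.coeff))
    (((Set.countable_range _).union (Set.countable_range _)).union
      ((Set.countable_range _).union (Set.countable_range _)))
  have hNk : ∀ n, g.num.coeff n ∈ k := fun n => hSk (Or.inl (Or.inl ⟨n, rfl⟩))
  have hDk : ∀ n, g.denom.coeff n ∈ k := fun n => hSk (Or.inl (Or.inr ⟨n, rfl⟩))
  have hPk : ∀ n, P.coeff n ∈ k := fun n => hSk (Or.inr (Or.inl ⟨n, rfl⟩))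
  have hQk : ∀ n, Q.coeff n ∈ k := fun n => hSk (Or.inr (Or.inr ⟨n, rfl⟩))
  refine exists_isCircle_of_conj_mem_fibre hk hg hNk hDk fun x hx y hy => ?_
  refine hk.conj_mem_fibre hNk hDk g.isCoprime_num_denom (linearIndependent_num_denom hg) hPk hQk
    hlin (fun n => by rw [hP, coeff_map]; exact Complex.conj_ofReal _)
    (fun n => by rw [hQ, coeff_map]; exact Complex.conj_ofReal _) hx (fun w hw => ?_)
    (fun x' hx' => hhinj _ _ ((hval _ _).2 hx')) hy
  rw [← hval, hcomp, hcomp]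
  congr 1
  rw [toSphere_coe, toSphere_coe, ofCoords_eq_iff (eval_ne_zero_or g.isCoprime_num_denom _)
    (eval_ne_zero_or g.isCoprime_num_denom _)]
  exact hw
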